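/- Let $k$ be a field and $V$ a $k$-vector space (of arbitrary dimension). For subspaces $A,B\subseteq V$ write $A<B$ if $(A+B)/B$ is finite dimensional, and $A\sim B$ if $(A+B)/(A\cap B)$ is finite dimensional. A family $\{V_i\}_{i\in I}$ of subspaces of $V$ is called reciprocity-admissible if $$\sum_{i\in I}V_i\sim V\qquad\text{and}\qquad V_i\cap\Big[\sum_{j\neq i}V_j\Big]\sim\{0\}\ \text{ for all } i\in I .$$ Let $E(V,\{V_i\}_{i\in I})$ be the set of $\varphi\in\operatorname{End}_k(V)$ such that $\varphi(V_i)<V_i$ for all $i$, and such that $\varphi(V_i)=V_i$ or $\varphi(V_i)=\{0\}$ for all but finitely many $i$. For a finite potent $\varphi\in\operatorname{End}_k(V)$ (that is, $\varphi^nV$ is finite dimensional for some $n$) let $\operatorname{tr}_V(\varphi)$ denote Tate's trace, i.e. the ordinary trace of $\varphi$ on the finite-dimensional invariant subspace $\varphi^nV$. For a subspace $A\subseteq V$ let $E$, $E_1$, $E_2$ be the sets of $\varphi\in\operatorname{End}_k(V)$ with $\varphi A<A$, $\varphi V<A$, $\varphi A<\{0\}$ respectively. If $K$ is a commutative $k$-algebra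 and $V$ is a $K$-module (compatibly with its $k$-structure) such that $fA<A$ for all $f\in K$, the abstract residue is the unique $k$-linear map $\operatorname{res}^V_A:\Omega^1_{K/k}\to k$ such that, for all $f,g\in K$ and all $f_1,g_1\in E$ with $f\equiv f_1$ and $g\equiv g_1 \pmod{E_2}$ and with $f_1\in E_1$ or $g_1\in E_1$, the commutator $[f_1,g_1]=f_1g_1-g_1f_1$ is finite potent and $\operatorname{res}^V_A(f\,dg)=\operatorname{tr}_V([f_1,g_1])$. **Corollary.** Let $\{V_i\}_{i\in I}$ be a reciprocity-admissible family of subspaces of $V$, and let $K$ be a commutative $k$-algebra acting on $V$ such that every $f\in K$ acts through an element of $E(V,\{V_i\}_{i\in I})$ (for example a commutative $k$-subalgebra $K$ of $\operatorname{End}_k(V)$ contained in $E(V,\{V_i\}_{i\in I})$). Then the abstract residues $\operatorname{res}^V_{V_i}:\Omega^1_{K/k}\to k$ exist and are unique for all $i\in I$, and for all $g,h\in K$ $$\sum_{i\in I}\operatorname{res}^V_{V_i}(g\,dh)=0 ,$$ where only a finite number of terms are different from $0$. -/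

import Mathlib

open scoped KaehlerDifferential

noncomputable section

namespace TateResidue

section Subspaces

variable {k V : Type*} [Field k] [AddCommGroup V] [Module k V]

/-- `A < B`, up to finite dimension: `(A + B) / B` is finite dimensional. -/
def AlmostLE (A B : Submodule k V) : Prop :=
  FiniteDimensional k (↥(A ⊔ B) ⧸ B.submoduleOf (A ⊔ B))

/-- `A ∼ B`: `(A + B) / (A ∩ B)` is finite dimensional. -/
def Commensurable (A B : Submodule k V) : Prop :=
  FiniteDimensional k (↥(A ⊔ B) ⧸ (A ⊓ B).submoduleOf (A ⊔ B))

/-- A family of subspaces `W i` of `V` is reciprocity-admissible if `∑ W i ∼ V` and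
`W i ∩ ∑_{j ≠ i} W j ∼ 0` for every `i`. -/
structure ReciprocityAdmissible {I : Type*} (W : I → Submodule k V) : Prop where
  iSup_commensurable : Commensurable (⨆ i, W i) ⊤
  inf_commensurable : ∀ i, Commensurable (W i ⊓ ⨆ j, ⨆ _ : j ≠ i, W j) ⊥

/-- `φ` is finite potent if `φ ^ n V` is finite dimensional for some `n`. -/
def FinitePotent (φ : Module.End k V) : Prop :=
  ∃ n : ℕ, FiniteDimensional k (LinearMap.range (φ ^ n))

theorem mapsTo_range_pow (φ : Module.End k V) (n : ℕ) :
    ∀ x ∈ LinearMap.range (φ ^ n), φ x ∈ LinearMap.range (φ ^ n) := by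
  rintro _ ⟨y, rfl⟩
  exact ⟨φ y, by rw [← Module.End.mul_apply, ← Module.End.mul_apply, ← pow_succ, ← pow_succ']⟩

open Classical in
/-- Tate's trace of a finite potent endomorphism: the ordinary trace of `φ` on the invariant
subspace `φ ^ n V`, for the least `n` for which that subspace is finite dimensional
(and `0` if `φ` is not finite potent). -/
def finitePotentTrace (φ : Module.End k V) : k :=
  if h : ∃ n : ℕ, FiniteDimensional k (LinearMap.range (φ ^ n)) then
    LinearMap.trace k (LinearMap.range (φ ^ Nat.find h))
      (φ.restrict (mapsTo_range_pow φ (Nat.find h)))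
  else 0

/-- `E = E(V, A)`: the endomorphisms `φ` with `φ A < A`. -/
def E (A : Submodule k V) : Set (Module.End k V) := {φ | AlmostLE (A.map φ) A}

/-- `E₁`: the endomorphisms `φ` with `φ V < A`. -/
def E₁ (A : Submodule k V) : Set (Module.End k V) := {φ | AlmostLE ((⊤ : Submodule k V).map φ) A}

/-- `E₂`: the endomorphisms `φ` with `φ A < 0`. -/
def E₂ (A : Submodule k V) : Set (Module.End k V) := {φ | AlmostLE (A.map φ) ⊥}

/-- The restricted endomorphisms `E(V, {W i})`: `φ (W i) < W i` for all `i`, and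
`φ (W i) = W i` or `φ (W i) = 0` for all but finitely many `i`. -/
def restrictedEnd {I : Type*} (W : I → Submodule k V) : Set (Module.End k V) :=
  {φ | (∀ i, φ ∈ E (W i)) ∧ {i | ¬ ((W i).map φ = W i ∨ (W i).map φ = ⊥)}.Finite}

end Subspaces

section Residue

variable {k : Type*} (K : Type*) {V : Type*} [Field k] [CommRing K] [Algebra k K]
  [AddCommGroup V] [Module k V] [Module K V] [IsScalarTower k K V]

/-- The defining property of the residue map on the Kähler differentials of `K` over `k`:
`res (f dg) = tr [f₁, g₁]` whenever `f₁, g₁ ∈ E` are congruent to (the action on `V` of) `f, g`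
modulo `E₂` and one of them lies in `E₁`. Here `Algebra.lsmul k k V f` is the endomorphism
`v ↦ f • v`, and `⁅f₁, g₁⁆ = f₁ * g₁ - g₁ * f₁`. -/
def IsAbstractResidue (A : Submodule k V) (r : Ω[K⁄k] →ₗ[k] k) : Prop :=
  ∀ (f g : K) (f₁ g₁ : Module.End k V), f₁ ∈ E A → g₁ ∈ E A →
    Algebra.lsmul k k V f - f₁ ∈ E₂ A → Algebra.lsmul k k V g - g₁ ∈ E₂ A →
    (f₁ ∈ E₁ A ∨ g₁ ∈ E₁ A) →
    FinitePotent ⁅f₁, g₁⁆ ∧ r (f • KaehlerDifferential.D k K g) = finitePotentTrace ⁅f₁, g₁⁆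

open Classical in
/-- Tate's abstract residue `res_A^V`: the unique `k`-linear map with the defining property
(with value `0` if there is no unique such map). -/
def abstractResidue (A : Submodule k V) : Ω[K⁄k] →ₗ[k] k :=
  if h : ∃! r : Ω[K⁄k] →ₗ[k] k, IsAbstractResidue K A r then h.choose else 0

end Residue

end TateResidue

end

/-! Let `π` be a projection onto `A`. Then `πf` lies in `E₁` and is congruent to `f` modulo `E₂`, so
the residue of `f dg` must be `tr ⁅πf, g⁆`, called the residue symbol. Since `f` and `g` commute,
this bracket lies in `E₀ = E₁ ∩ E₂`, where a product of any two elements has finite rank. Tate's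
trace is therefore additive on `E₀`, and brackets whose two products lie in `E₀` have trace zero.
Hence the symbol is independent of the choice of representatives (`finitePotentTrace_lie_congr`) and
obeys the Leibniz rule (`residueSymbol_mul_right`), so it descends to the Kähler differentials.

Three properties of the symbol give reciprocity. It vanishes when `f` and `g` preserve `A` exactly
(`residueSymbol_eq_zero_of_mapsTo`). It vanishes when `A ∼ V`, because then `f` itself lies in `E₁`
and `⁅f, g⁆ = 0` (`residueSymbol_eq_zero_of_almostLE`). It is additive on `A + B` when `A ∩ B` is
finite dimensional (`residueSymbol_sup`). Outside a finite set `J` of indices, both `g` and `h`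
preserve `W i`. Write `V`, up to finite dimension, as the sum of the `W i` over `J` plus the sum of
the remaining ones: the total symbol is zero, the second summand contributes zero, and the first
contributes the sum over `J`. -/

noncomputable section

namespace TateResidue

/-! ### Inclusion of subspaces up to finite dimension -/

section AlmostInclusion

variable {k V : Type*} [Field k] [AddCommGroup V] [Module k V]

/-- A complement of `N ∩ M` in `M` serves as `F`; conversely the quotient is the image of `M` in `V
/ N`, which lies in the image of `F`. This replaces quotients by plain inclusions in both `AlmostLE`
and `Commensurable`. -/
theorem finiteDimensional_quotient_submoduleOf_iff {N M : Submodule k V} :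
    FiniteDimensional k (↥M ⧸ N.submoduleOf M) ↔ ∃ F : Submodule k V, F.FG ∧ M ≤ N ⊔ F := by
  constructor
  · intro hfin
    obtain ⟨Q, hQ⟩ := Submodule.exists_isCompl (N.submoduleOf M)
    have hQfin : FiniteDimensional k Q :=
      (Submodule.quotientEquivOfIsCompl _ _ hQ).finiteDimensional
    refine ⟨Q.map M.subtype, (Module.Finite.iff_fg.mp hQfin).map _, fun x hx => ?_⟩
    have hx' : (⟨x, hx⟩ : M) ∈ N.submoduleOf M ⊔ Q := by rw [hQ.sup_eq_top]; trivial
    obtain ⟨y, hy, z, hz, hyz⟩ := Submodule.mem_sup.mp hx'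
    exact Submodule.mem_sup.mpr ⟨y, hy, z, ⟨z, hz, rfl⟩, congrArg Subtype.val hyz⟩
  · rintro ⟨F, hF, hM⟩
    let φ : ↥M →ₗ[k] V ⧸ N := N.mkQ ∘ₗ M.subtype
    have hker : LinearMap.ker φ = N.submoduleOf M := by
      ext x
      simp [φ, Submodule.submoduleOf]
    have hrange : LinearMap.range φ ≤ F.map N.mkQ := by
      rintro _ ⟨x, rfl⟩
      obtain ⟨y, hy, z, hz, hyz⟩ := Submodule.mem_sup.mp (hM x.2)
      refine ⟨z, hz, ?_⟩
      simp only [φ, LinearMap.comp_apply, Submodule.subtype_apply, ← hyz, map_add]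
      rw [show N.mkQ y = 0 by simpa using hy, zero_add]
    have : FiniteDimensional k (F.map N.mkQ) := Module.Finite.iff_fg.mpr (hF.map _)
    have : FiniteDimensional k (LinearMap.range φ) := Submodule.finiteDimensional_of_le hrange
    rw [← hker]
    exact φ.quotKerEquivRange.symm.finiteDimensional

theorem almostLE_iff {A B : Submodule k V} :
    AlmostLE A B ↔ ∃ F : Submodule k V, F.FG ∧ A ≤ B ⊔ F := by
  rw [AlmostLE, finiteDimensional_quotient_submoduleOf_iff]
  simp only [sup_le_iff, le_sup_left, and_true]

theorem Commensurable.almostLE_left {A B : Submodule k V} (h : Commensurable A B) :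
    AlmostLE A B := by
  obtain ⟨F, hF, hle⟩ := finiteDimensional_quotient_submoduleOf_iff.mp h
  exact almostLE_iff.mpr ⟨F, hF, (le_sup_left.trans hle).trans (sup_le_sup_right inf_le_right _)⟩

theorem Commensurable.almostLE_right {A B : Submodule k V} (h : Commensurable A B) :
    AlmostLE B A := by
  obtain ⟨F, hF, hle⟩ := finiteDimensional_quotient_submoduleOf_iff.mp h
  exact almostLE_iff.mpr ⟨F, hF, (le_sup_right.trans hle).trans (sup_le_sup_right inf_le_left _)⟩

theorem AlmostLE.of_le {A B : Submodule k V} (h : A ≤ B) : AlmostLE A B :=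
  almostLE_iff.mpr ⟨⊥, Submodule.fg_bot, h.trans le_sup_left⟩

theorem AlmostLE.trans {A B C : Submodule k V} (h₁ : AlmostLE A B) (h₂ : AlmostLE B C) :
    AlmostLE A C := by
  obtain ⟨F, hF, hAB⟩ := almostLE_iff.mp h₁
  obtain ⟨G, hG, hBC⟩ := almostLE_iff.mp h₂
  refine almostLE_iff.mpr ⟨G ⊔ F, hG.sup hF, hAB.trans ?_⟩
  rw [← sup_assoc]
  exact sup_le_sup_right hBC _

theorem AlmostLE.sup {A B C : Submodule k V} (h₁ : AlmostLE A C) (h₂ : AlmostLE B C) :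
    AlmostLE (A ⊔ B) C := by
  obtain ⟨F, hF, hA⟩ := almostLE_iff.mp h₁
  obtain ⟨G, hG, hB⟩ := almostLE_iff.mp h₂
  exact almostLE_iff.mpr ⟨F ⊔ G, hF.sup hG, sup_le (hA.trans (sup_le_sup_left le_sup_left _))
    (hB.trans (sup_le_sup_left le_sup_right _))⟩

theorem AlmostLE.map {A B : Submodule k V} (h : AlmostLE A B) (φ : Module.End k V) :
    AlmostLE (A.map φ) (B.map φ) := by
  obtain ⟨F, hF, hA⟩ := almostLE_iff.mp h
  refine almostLE_iff.mpr ⟨F.map φ, hF.map _, ?_⟩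
  rw [← Submodule.map_sup]
  exact Submodule.map_mono hA

theorem almostLE_bot_iff {A : Submodule k V} : AlmostLE A ⊥ ↔ FiniteDimensional k A := by
  rw [almostLE_iff]
  constructor
  · rintro ⟨F, hF, h⟩
    have : FiniteDimensional k F := Module.Finite.iff_fg.mpr hF
    exact Submodule.finiteDimensional_of_le (by simpa using h)
  · intro h
    exact ⟨A, Module.Finite.iff_fg.mp h, le_sup_right⟩

theorem AlmostLE.map_add {A B : Submodule k V} {φ ψ : Module.End k V}
    (hφ : AlmostLE (A.map φ) B) (hψ : AlmostLE (A.map ψ) B) : AlmostLE (A.map (φ + ψ)) B :=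
  (AlmostLE.of_le (Submodule.map_add_le A φ ψ)).trans (hφ.sup hψ)

theorem AlmostLE.map_smul {A B : Submodule k V} {φ : Module.End k V} (c : k)
    (hφ : AlmostLE (A.map φ) B) : AlmostLE (A.map (c • φ)) B := by
  refine (AlmostLE.of_le ?_).trans hφ
  rintro _ ⟨x, hx, rfl⟩
  exact ⟨c • x, A.smul_mem c hx, by simp⟩

theorem AlmostLE.map_mul {A B C : Submodule k V} {φ ψ : Module.End k V}
    (hφ : AlmostLE (B.map φ) C) (hψ : AlmostLE (A.map ψ) B) : AlmostLE (A.map (φ * ψ)) C := by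
  rw [Module.End.mul_eq_comp, Submodule.map_comp]
  exact (hψ.map φ).trans hφ

end AlmostInclusion

/-! ### Endomorphisms respecting subspaces up to finite dimension -/

section Ideals

variable {k V : Type*} [Field k] [AddCommGroup V] [Module k V] {A B : Submodule k V}
  {φ ψ : Module.End k V}

/-- The endomorphisms carrying `A` into `B` up to finite dimension. -/
def almostMaps (A B : Submodule k V) : Submodule k (Module.End k V) where
  carrier := {φ | AlmostLE (A.map φ) B}
  add_mem' := AlmostLE.map_add
  zero_mem' := AlmostLE.of_le (by simp)
  smul_mem' c _ := AlmostLE.map_smul c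

theorem mem_E₂_iff : φ ∈ E₂ A ↔ φ ∈ almostMaps A ⊥ := Iff.rfl

theorem mul_mem_almostMaps {C : Submodule k V} (hφ : φ ∈ almostMaps B C)
    (hψ : ψ ∈ almostMaps A B) : φ * ψ ∈ almostMaps A C := hφ.map_mul hψ

/-- Monotonicity holds even for almost inclusions, so subspaces may be replaced by commensurable
ones. -/
theorem almostMaps_mono {A' B' : Submodule k V} (hA : AlmostLE A' A) (hB : AlmostLE B B') :
    almostMaps A B ≤ almostMaps A' B' := fun φ hφ => ((hA.map φ).trans hφ).trans hB

theorem mem_almostMaps_of_mapsTo (h : ∀ x ∈ A, φ x ∈ B) : φ ∈ almostMaps A B :=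
  AlmostLE.of_le (Submodule.map_le_iff_le_comap.mpr h)

theorem almostMaps_top_le : almostMaps ⊤ B ≤ almostMaps A B :=
  almostMaps_mono (AlmostLE.of_le le_top) (AlmostLE.of_le le_rfl)

theorem almostMaps_bot_le : almostMaps A ⊥ ≤ almostMaps A B :=
  almostMaps_mono (AlmostLE.of_le le_rfl) (AlmostLE.of_le bot_le)

theorem mem_almostMaps_from_bot : φ ∈ almostMaps ⊥ B := AlmostLE.of_le (by simp)

theorem mem_almostMaps_top_top : φ ∈ almostMaps ⊤ ⊤ := AlmostLE.of_le le_top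

theorem mem_almostMaps_sup {C : Submodule k V} (hA : φ ∈ almostMaps A C)
    (hB : φ ∈ almostMaps B C) : φ ∈ almostMaps (A ⊔ B) C := by
  change AlmostLE ((A ⊔ B).map φ) C
  rw [Submodule.map_sup]
  exact hA.sup hB

theorem mem_almostMaps_top_bot_iff :
    φ ∈ almostMaps ⊤ ⊥ ↔ FiniteDimensional k (LinearMap.range φ) := by
  rw [← Submodule.map_top φ]
  exact almostLE_bot_iff

/-- The endomorphisms lying in both `E₁` and `E₂`. -/
def E₀ (A : Submodule k V) : Submodule k (Module.End k V) := almostMaps ⊤ A ⊓ almostMaps A ⊥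

end Ideals

/-! ### Tate's trace of finite potent endomorphisms -/

section Trace

variable {k V : Type*} [Field k] [AddCommGroup V] [Module k V]

/-- The two restrictions are the two composites of the inclusion `U → W` with `φ : W → U`. -/
theorem trace_restrict_eq_of_map_le (φ : Module.End k V) {U W : Submodule k V}
    [FiniteDimensional k U] [FiniteDimensional k W]
    (hU : ∀ x ∈ U, φ x ∈ U) (hW : ∀ x ∈ W, φ x ∈ W) (hUW : U ≤ W) (h : ∀ x ∈ W, φ x ∈ U) :
    LinearMap.trace k W (φ.restrict hW) = LinearMap.trace k U (φ.restrict hU) :=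
  (LinearMap.trace_comp_comm' (Submodule.inclusion hUW) (φ.restrict h)).symm

theorem trace_restrict_eq_of_map_pow_le (φ : Module.End k V) {U : Submodule k V}
    [FiniteDimensional k U] (hU : ∀ x ∈ U, φ x ∈ U) (n : ℕ) :
    ∀ {W : Submodule k V} [FiniteDimensional k W] (hW : ∀ x ∈ W, φ x ∈ W), U ≤ W →
      (∀ x ∈ W, (φ ^ n) x ∈ U) →
      LinearMap.trace k W (φ.restrict hW) = LinearMap.trace k U (φ.restrict hU) := by
  induction n with
  | zero =>
    intro W _ hW hUW h
    obtain rfl : U = W := le_antisymm hUW fun x hx => by simpa using h x hx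
    rfl
  | succ n ih =>
    intro W _ hW hUW h
    -- One application of `φ` carries `W` into `U + φ W`, and `φ ^ n` carries that space into `U`.
    have hle : U ⊔ W.map φ ≤ W := sup_le hUW (Submodule.map_le_iff_le_comap.mpr hW)
    have hmaps : ∀ x ∈ W, φ x ∈ U ⊔ W.map φ := fun x hx =>
      Submodule.mem_sup_right (Submodule.mem_map_of_mem hx)
    have hinv : ∀ x ∈ U ⊔ W.map φ, φ x ∈ U ⊔ W.map φ := fun x hx => hmaps x (hle hx)
    have : FiniteDimensional k ↥(U ⊔ W.map φ) := Submodule.finiteDimensional_of_le hle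
    rw [trace_restrict_eq_of_map_le φ hinv hW hle hmaps]
    refine ih hinv le_sup_left fun x hx => ?_
    obtain ⟨y, hy, _, ⟨z, hz, rfl⟩, rfl⟩ := Submodule.mem_sup.mp hx
    rw [map_add]
    refine U.add_mem (Module.End.pow_apply_mem_of_forall_mem n hU y hy) ?_
    rw [← Module.End.mul_apply, ← pow_succ]
    exact h z hz

theorem range_pow_le_of_le (φ : Module.End k V) {m n : ℕ} (h : m ≤ n) :
    LinearMap.range (φ ^ n) ≤ LinearMap.range (φ ^ m) := by
  rintro _ ⟨x, rfl⟩
  exact ⟨(φ ^ (n - m)) x, by rw [← Module.End.mul_apply, ← pow_add, Nat.add_sub_cancel' h]⟩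

/-- The space `φ ^ n V` lies both in `W` and in the image of the least admissible power, and `φ ^ n`
maps each of them into it; so all three traces agree. -/
theorem finitePotentTrace_eq_trace_restrict (φ : Module.End k V) {W : Submodule k V}
    [FiniteDimensional k W] (hW : ∀ x ∈ W, φ x ∈ W) {n : ℕ} (hn : LinearMap.range (φ ^ n) ≤ W) :
    finitePotentTrace φ = LinearMap.trace k W (φ.restrict hW) := by
  classical
  have hfin : FiniteDimensional k (LinearMap.range (φ ^ n)) := Submodule.finiteDimensional_of_le hn
  have hex : ∃ n : ℕ, FiniteDimensional k (LinearMap.range (φ ^ n)) := ⟨n, hfin⟩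
  have hfind : FiniteDimensional k (LinearMap.range (φ ^ Nat.find hex)) := Nat.find_spec hex
  rw [finitePotentTrace, dif_pos hex,
    trace_restrict_eq_of_map_pow_le φ (mapsTo_range_pow φ n) n hW hn fun x _ => ⟨x, rfl⟩]
  exact trace_restrict_eq_of_map_pow_le φ (mapsTo_range_pow φ n) n _
    (range_pow_le_of_le φ (Nat.find_min' hex hfin)) fun x _ => ⟨x, rfl⟩

theorem finitePotentTrace_smul {φ : Module.End k V} (hφ : FinitePotent φ) (c : k) :
    finitePotentTrace (c • φ) = c * finitePotentTrace φ := by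
  obtain ⟨n, hn⟩ := hφ
  have hinv := mapsTo_range_pow φ n
  rw [finitePotentTrace_eq_trace_restrict φ hinv le_rfl,
    finitePotentTrace_eq_trace_restrict (W := LinearMap.range (φ ^ n)) (c • φ)
      (fun x hx => Submodule.smul_mem _ c (hinv x hx)) (n := n), ← smul_eq_mul, ← map_smul]
  · rfl
  · rw [smul_pow]
    rintro _ ⟨x, rfl⟩
    exact ⟨c ^ n • x, by simp⟩

theorem finitePotentTrace_eq_zero_of_sq {φ : Module.End k V} (h : φ ^ 2 = 0) :
    finitePotentTrace φ = 0 := by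
  rw [finitePotentTrace_eq_trace_restrict (W := ⊥) φ (by simp) (n := 2) (by simp [h])]
  convert map_zero (LinearMap.trace k (⊥ : Submodule k V))
  exact Subsingleton.elim _ _

/-- The sum of the images of the four products is a finite-dimensional space stable under `φ` and
`ψ` that contains the images of `φ ^ 2`, `ψ ^ 2` and `(φ + ψ) ^ 2`; all three traces are ordinary
traces there. -/
theorem finitePotentTrace_add {φ ψ : Module.End k V}
    (h₁ : φ * φ ∈ almostMaps ⊤ ⊥) (h₂ : φ * ψ ∈ almostMaps ⊤ ⊥)
    (h₃ : ψ * φ ∈ almostMaps ⊤ ⊥) (h₄ : ψ * ψ ∈ almostMaps ⊤ ⊥) :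
    finitePotentTrace (φ + ψ) = finitePotentTrace φ + finitePotentTrace ψ := by
  rw [mem_almostMaps_top_bot_iff] at h₁ h₂ h₃ h₄
  let W := (LinearMap.range (φ * φ) ⊔ LinearMap.range (φ * ψ)) ⊔
    (LinearMap.range (ψ * φ) ⊔ LinearMap.range (ψ * ψ))
  have hφφ : ∀ x, φ (φ x) ∈ W := fun x =>
    Submodule.mem_sup_left (Submodule.mem_sup_left ⟨x, rfl⟩)
  have hφψ : ∀ x, φ (ψ x) ∈ W := fun x =>
    Submodule.mem_sup_left (Submodule.mem_sup_right ⟨x, rfl⟩)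
  have hψφ : ∀ x, ψ (φ x) ∈ W := fun x =>
    Submodule.mem_sup_right (Submodule.mem_sup_left ⟨x, rfl⟩)
  have hψψ : ∀ x, ψ (ψ x) ∈ W := fun x =>
    Submodule.mem_sup_right (Submodule.mem_sup_right ⟨x, rfl⟩)
  have hW : ∀ w ∈ W, ∃ x y, w = φ x + ψ y := by
    intro w hw
    obtain ⟨_, hu, _, hv, rfl⟩ := Submodule.mem_sup.mp hw
    obtain ⟨_, ⟨a, rfl⟩, _, ⟨b, rfl⟩, rfl⟩ := Submodule.mem_sup.mp hu
    obtain ⟨_, ⟨c, rfl⟩, _, ⟨d, rfl⟩, rfl⟩ := Submodule.mem_sup.mp hv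
    exact ⟨φ a + ψ b, φ c + ψ d, by simp⟩
  have hφ : ∀ x ∈ W, φ x ∈ W := by
    intro w hw
    obtain ⟨x, y, rfl⟩ := hW w hw
    rw [map_add]
    exact W.add_mem (hφφ x) (hφψ y)
  have hψ : ∀ x ∈ W, ψ x ∈ W := by
    intro w hw
    obtain ⟨x, y, rfl⟩ := hW w hw
    rw [map_add]
    exact W.add_mem (hψφ x) (hψψ y)
  rw [finitePotentTrace_eq_trace_restrict (W := W) φ hφ (n := 2),
    finitePotentTrace_eq_trace_restrict (W := W) ψ hψ (n := 2),
    finitePotentTrace_eq_trace_restrict (W := W) (φ + ψ)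
      (fun x hx => W.add_mem (hφ x hx) (hψ x hx)) (n := 2), ← map_add]
  · rfl
  · rintro _ ⟨x, rfl⟩
    rw [pow_two]
    simp only [Module.End.mul_apply, LinearMap.add_apply, map_add]
    exact W.add_mem (W.add_mem (hφφ x) (hψφ x)) (W.add_mem (hφψ x) (hψψ x))
  · rintro _ ⟨x, rfl⟩
    exact hψψ x
  · rintro _ ⟨x, rfl⟩
    exact hφφ x

theorem finitePotentTrace_mul_comm {φ ψ : Module.End k V} (h : FinitePotent (φ * ψ)) :
    finitePotentTrace (φ * ψ) = finitePotentTrace (ψ * φ) := by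
  obtain ⟨n, hn⟩ := h
  have key : ∀ a b : Module.End k V, ∀ n, a * (b * a) ^ n = (a * b) ^ n * a := fun a b n =>
    (show SemiconjBy a (b * a) (a * b) from by simp [SemiconjBy, mul_assoc]).pow_right n
  have hfin : FiniteDimensional k (LinearMap.range ((φ * ψ) ^ n)) := hn
  let W' := (LinearMap.range ((φ * ψ) ^ n)).map ψ
  have hψ : ∀ x ∈ LinearMap.range ((φ * ψ) ^ n), ψ x ∈ W' := fun x hx => ⟨x, hx, rfl⟩
  have hφ : ∀ x ∈ W', φ x ∈ LinearMap.range ((φ * ψ) ^ n) := by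
    rintro _ ⟨x, hx, rfl⟩
    exact mapsTo_range_pow (φ * ψ) n x hx
  have hW' : FiniteDimensional k W' := inferInstance
  -- The extra power comes from `(ψφ) ^ (n + 1) = ψ (φψ) ^ n φ`.
  have hle : LinearMap.range ((ψ * φ) ^ (n + 1)) ≤ W' := by
    rintro _ ⟨x, rfl⟩
    refine ⟨((φ * ψ) ^ n) (φ x), ⟨φ x, rfl⟩, ?_⟩
    rw [← Module.End.mul_apply, ← Module.End.mul_apply, key ψ φ n, mul_assoc, ← pow_succ]
  rw [finitePotentTrace_eq_trace_restrict (φ * ψ) (fun x hx => hφ _ (hψ x hx)) le_rfl,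
    finitePotentTrace_eq_trace_restrict (ψ * φ) (fun x hx => hψ _ (hφ x hx)) hle]
  exact (LinearMap.trace_comp_comm' (φ.restrict hφ) (ψ.restrict hψ)).symm

end Trace

/-! ### Bracket identities in a ring -/

section RingCommutator

variable {R : Type*} [Ring R] (a b c : R)

theorem ring_add_lie : ⁅a + b, c⁆ = ⁅a, c⁆ + ⁅b, c⁆ := by
  simp only [Ring.lie_def, add_mul, mul_add]
  abel

theorem ring_lie_add : ⁅a, b + c⁆ = ⁅a, b⁆ + ⁅a, c⁆ := by
  simp only [Ring.lie_def, add_mul, mul_add]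
  abel

theorem ring_sub_lie : ⁅a - b, c⁆ = ⁅a, c⁆ - ⁅b, c⁆ := by
  simp only [Ring.lie_def, sub_mul, mul_sub]
  abel

theorem ring_lie_sub : ⁅a, b - c⁆ = ⁅a, b⁆ - ⁅a, c⁆ := by
  simp only [Ring.lie_def, sub_mul, mul_sub]
  abel

theorem ring_lie_skew : -⁅b, a⁆ = ⁅a, b⁆ := by
  simp only [Ring.lie_def, neg_sub]

end RingCommutator

/-! ### Traces of commutators and independence of representatives -/

section Commutators

variable {k V : Type*} [Field k] [AddCommGroup V] [Module k V] {A B : Submodule k V}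

theorem finitePotent_of_mem_E₀ {φ : Module.End k V} (h : φ ∈ E₀ A) : FinitePotent φ := by
  refine ⟨2, mem_almostMaps_top_bot_iff.mp ?_⟩
  rw [pow_two]
  exact mul_mem_almostMaps h.2 h.1

theorem finitePotentTrace_add_of_mem_E₀ {φ ψ : Module.End k V} (hφ : φ ∈ E₀ A) (hψ : ψ ∈ E₀ A) :
    finitePotentTrace (φ + ψ) = finitePotentTrace φ + finitePotentTrace ψ :=
  finitePotentTrace_add (mul_mem_almostMaps hφ.2 hφ.1) (mul_mem_almostMaps hφ.2 hψ.1)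
    (mul_mem_almostMaps hψ.2 hφ.1) (mul_mem_almostMaps hψ.2 hψ.1)

theorem finitePotentTrace_neg {φ : Module.End k V} (hφ : φ ∈ E₀ A) :
    finitePotentTrace (-φ) = -finitePotentTrace φ := by
  rw [← neg_one_smul k φ, finitePotentTrace_smul (finitePotent_of_mem_E₀ hφ), neg_one_mul]

theorem finitePotentTrace_sub {φ ψ : Module.End k V} (hφ : φ ∈ E₀ A) (hψ : ψ ∈ E₀ A) :
    finitePotentTrace (φ - ψ) = finitePotentTrace φ - finitePotentTrace ψ := by
  rw [sub_eq_add_neg, finitePotentTrace_add_of_mem_E₀ hφ (neg_mem hψ), finitePotentTrace_neg hψ,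
    sub_eq_add_neg]

theorem finitePotentTrace_lie_eq_zero {φ ψ : Module.End k V} (h₁ : φ * ψ ∈ E₀ A)
    (h₂ : ψ * φ ∈ E₀ A) : finitePotentTrace ⁅φ, ψ⁆ = 0 := by
  rw [Ring.lie_def, finitePotentTrace_sub h₁ h₂,
    finitePotentTrace_mul_comm (finitePotent_of_mem_E₀ h₁), sub_self]

theorem lie_mem_almostMaps_top {a b : Module.End k V} (ha : a ∈ almostMaps ⊤ A)
    (hb : b ∈ almostMaps A A) : ⁅a, b⁆ ∈ almostMaps ⊤ A :=
  sub_mem (mul_mem_almostMaps ha mem_almostMaps_top_top) (mul_mem_almostMaps hb ha)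

theorem lie_mem_almostMaps_bot {a b : Module.End k V} (ha : a ∈ almostMaps A ⊥)
    (hb : b ∈ almostMaps A A) : ⁅a, b⁆ ∈ almostMaps A ⊥ :=
  sub_mem (mul_mem_almostMaps ha hb) (mul_mem_almostMaps mem_almostMaps_from_bot ha)

/-- As `⁅f, g⁆ = 0`, the bracket can be rewritten with the differences `f - f₁` and `g - g₁`, which
are in `E₂`. -/
theorem lie_mem_E₀_of_congr {f g f₁ g₁ : Module.End k V} (hfg : Commute f g)
    (hf₁ : f₁ ∈ almostMaps ⊤ A) (hg : g ∈ almostMaps A A) (hg₁ : g₁ ∈ almostMaps A A)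
    (hff₁ : f - f₁ ∈ almostMaps A ⊥) (hgg₁ : g - g₁ ∈ almostMaps A ⊥) : ⁅f₁, g₁⁆ ∈ E₀ A := by
  refine ⟨lie_mem_almostMaps_top hf₁ hg₁, ?_⟩
  have h : ⁅f₁, g₁⁆ = ⁅g - g₁, f₁⁆ - ⁅f - f₁, g⁆ := by
    have := hfg.eq
    simp only [Ring.lie_def, sub_mul, mul_sub, this]
    abel
  rw [h]
  exact sub_mem (lie_mem_almostMaps_bot hgg₁ (almostMaps_top_le hf₁))
    (lie_mem_almostMaps_bot hff₁ hg)

/-- One entry is changed at a time. Each change alters the bracket by one whose two products lie in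
`E₀`, hence of trace zero. -/
theorem finitePotentTrace_lie_congr {f g f₁ g₁ f₂ g₂ : Module.End k V} (hfg : Commute f g)
    (hg : g ∈ almostMaps A A) (hf₁ : f₁ ∈ almostMaps ⊤ A) (hf₂ : f₂ ∈ almostMaps ⊤ A)
    (hg₁ : g₁ ∈ almostMaps A A) (hg₂ : g₂ ∈ almostMaps A A)
    (hff₁ : f - f₁ ∈ almostMaps A ⊥) (hff₂ : f - f₂ ∈ almostMaps A ⊥)
    (hgg₁ : g - g₁ ∈ almostMaps A ⊥) (hgg₂ : g - g₂ ∈ almostMaps A ⊥) :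
    finitePotentTrace ⁅f₁, g₁⁆ = finitePotentTrace ⁅f₂, g₂⁆ := by
  have h₁₁ := lie_mem_E₀_of_congr hfg hf₁ hg hg₁ hff₁ hgg₁
  have h₁₂ := lie_mem_E₀_of_congr hfg hf₁ hg hg₂ hff₁ hgg₂
  have h₂₂ := lie_mem_E₀_of_congr hfg hf₂ hg hg₂ hff₂ hgg₂
  have hf : f₁ - f₂ ∈ E₀ A := ⟨sub_mem hf₁ hf₂, by simpa using sub_mem hff₂ hff₁⟩
  have hgd : g₁ - g₂ ∈ almostMaps A ⊥ := by simpa using sub_mem hgg₂ hgg₁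
  have hf₁' : f₁ ∈ almostMaps A A := almostMaps_top_le hf₁
  have e₁ : finitePotentTrace ⁅f₁, g₁ - g₂⁆ = 0 :=
    finitePotentTrace_lie_eq_zero (A := A)
      ⟨mul_mem_almostMaps hf₁ mem_almostMaps_top_top,
        mul_mem_almostMaps mem_almostMaps_from_bot hgd⟩
      ⟨almostMaps_bot_le (mul_mem_almostMaps hgd hf₁), mul_mem_almostMaps hgd hf₁'⟩
  have e₂ : finitePotentTrace ⁅f₁ - f₂, g₂⁆ = 0 :=
    finitePotentTrace_lie_eq_zero (A := A)
      ⟨mul_mem_almostMaps hf.1 mem_almostMaps_top_top, mul_mem_almostMaps hf.2 hg₂⟩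
      ⟨mul_mem_almostMaps hg₂ hf.1, mul_mem_almostMaps mem_almostMaps_from_bot hf.2⟩
  rw [ring_lie_sub, finitePotentTrace_sub h₁₁ h₁₂, sub_eq_zero] at e₁
  rw [ring_sub_lie, finitePotentTrace_sub h₁₂ h₂₂, sub_eq_zero] at e₂
  exact e₁.trans e₂

end Commutators

/-! ### The residue symbol and its properties -/

section ResidueSymbol

variable {k V : Type*} [Field k] [AddCommGroup V] [Module k V] {A B : Submodule k V}

theorem exists_projection_of_disjoint (h : Disjoint A B) :
    ∃ p : Module.End k V, (∀ x, p x ∈ A) ∧ (∀ x ∈ A, p x = x) ∧ ∀ x ∈ B, p x = 0 := by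
  obtain ⟨C, hBC, hC⟩ := h.symm.exists_isCompl
  refine ⟨A.projection C hC.symm, A.projection_apply_mem hC.symm,
    fun x hx => Submodule.projection_apply_of_mem_left hC.symm hx, fun x hx => ?_⟩
  exact (Submodule.projection_apply_eq_zero_iff hC.symm).mpr (hBC hx)

/-- A linear projection of `V` onto `A`. -/
def chosenProjection (A : Submodule k V) : Module.End k V :=
  (exists_projection_of_disjoint (disjoint_bot_right : Disjoint A ⊥)).choose

theorem chosenProjection_mem (A : Submodule k V) (x : V) : chosenProjection A x ∈ A :=
  (exists_projection_of_disjoint (disjoint_bot_right : Disjoint A ⊥)).choose_spec.1 x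

theorem chosenProjection_apply_of_mem {x : V} (hx : x ∈ A) : chosenProjection A x = x :=
  (exists_projection_of_disjoint (disjoint_bot_right : Disjoint A ⊥)).choose_spec.2.1 x hx

/-- The trace of `⁅π f, g⁆`, where `π` is a projection onto `A`: the value of the residue at
`f dg`. -/
def residueSymbol (A : Submodule k V) (f g : Module.End k V) : k :=
  finitePotentTrace ⁅chosenProjection A * f, g⁆

theorem mul_mem_almostMaps_of_projection {p : Module.End k V} (hp : ∀ x, p x ∈ A)
    (f : Module.End k V) : p * f ∈ almostMaps ⊤ A :=
  mem_almostMaps_of_mapsTo fun x _ => hp (f x)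

theorem sub_mul_mem_almostMaps_of_projection {p : Module.End k V} (hp : ∀ x ∈ A, p x = x)
    {f : Module.End k V} (hf : f ∈ almostMaps B A) : f - p * f ∈ almostMaps B ⊥ := by
  have h : f - p * f = (1 - p) * f := by rw [sub_mul, one_mul]
  rw [h]
  exact mul_mem_almostMaps (mem_almostMaps_of_mapsTo fun x hx => by simp [hp x hx]) hf

theorem chosenProjection_mul_mem (f : Module.End k V) :
    chosenProjection A * f ∈ almostMaps ⊤ A :=
  mul_mem_almostMaps_of_projection (chosenProjection_mem A) f

theorem sub_chosenProjection_mul_mem {f : Module.End k V} (hf : f ∈ almostMaps A A) :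
    f - chosenProjection A * f ∈ almostMaps A ⊥ :=
  sub_mul_mem_almostMaps_of_projection (fun _ => chosenProjection_apply_of_mem) hf

theorem lie_chosenProjection_mul_mem_E₀ {f g : Module.End k V} (hfg : Commute f g)
    (hf : f ∈ almostMaps A A) (hg : g ∈ almostMaps A A) :
    ⁅chosenProjection A * f, g⁆ ∈ E₀ A :=
  lie_mem_E₀_of_congr hfg (chosenProjection_mul_mem f) hg hg (sub_chosenProjection_mul_mem hf)
    (by simp)

theorem finitePotentTrace_lie_eq_residueSymbol_left {f g f₁ g₁ : Module.End k V}
    (hfg : Commute f g) (hf : f ∈ almostMaps A A) (hg : g ∈ almostMaps A A)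
    (hf₁ : f₁ ∈ almostMaps ⊤ A) (hg₁ : g₁ ∈ almostMaps A A)
    (hff₁ : f - f₁ ∈ almostMaps A ⊥) (hgg₁ : g - g₁ ∈ almostMaps A ⊥) :
    finitePotentTrace ⁅f₁, g₁⁆ = residueSymbol A f g :=
  finitePotentTrace_lie_congr hfg hg hf₁ (chosenProjection_mul_mem f) hg₁ hg hff₁
    (sub_chosenProjection_mul_mem hf) hgg₁ (by simp)

/-- Both symbols can be computed from the pair `πf`, `πg`, where antisymmetry of the bracket
applies. -/
theorem residueSymbol_swap {f g : Module.End k V} (hfg : Commute f g)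
    (hf : f ∈ almostMaps A A) (hg : g ∈ almostMaps A A) :
    residueSymbol A g f = -residueSymbol A f g := by
  have hpf := chosenProjection_mul_mem (A := A) f
  have hpg := chosenProjection_mul_mem (A := A) g
  have hpf' := sub_chosenProjection_mul_mem hf
  have hpg' := sub_chosenProjection_mul_mem hg
  rw [← finitePotentTrace_lie_eq_residueSymbol_left hfg hf hg hpf (almostMaps_top_le hpg) hpf' hpg',
    ← finitePotentTrace_lie_eq_residueSymbol_left hfg.symm hg hf hpg (almostMaps_top_le hpf)
      hpg' hpf', ← finitePotentTrace_neg
      (lie_mem_E₀_of_congr hfg hpf hg (almostMaps_top_le hpg) hpf' hpg'), ring_lie_skew]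

theorem lie_mem_E₀_and_trace_eq_residueSymbol {f g f₁ g₁ : Module.End k V}
    (hfg : Commute f g) (hf : f ∈ almostMaps A A) (hg : g ∈ almostMaps A A)
    (hf₁ : f₁ ∈ almostMaps A A) (hg₁ : g₁ ∈ almostMaps A A)
    (hff₁ : f - f₁ ∈ almostMaps A ⊥) (hgg₁ : g - g₁ ∈ almostMaps A ⊥)
    (h : f₁ ∈ almostMaps ⊤ A ∨ g₁ ∈ almostMaps ⊤ A) :
    ⁅f₁, g₁⁆ ∈ E₀ A ∧ finitePotentTrace ⁅f₁, g₁⁆ = residueSymbol A f g := by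
  rcases h with h | h
  · exact ⟨lie_mem_E₀_of_congr hfg h hg hg₁ hff₁ hgg₁,
      finitePotentTrace_lie_eq_residueSymbol_left hfg hf hg h hg₁ hff₁ hgg₁⟩
  · have hmem := lie_mem_E₀_of_congr hfg.symm h hf hf₁ hgg₁ hff₁
    rw [← ring_lie_skew f₁ g₁]
    refine ⟨neg_mem hmem, ?_⟩
    rw [finitePotentTrace_neg hmem,
      finitePotentTrace_lie_eq_residueSymbol_left hfg.symm hg hf h hf₁ hgg₁ hff₁,
      residueSymbol_swap hfg hf hg, neg_neg]

/-- This is the Leibniz rule `f d(gh) = fg dh + fh dg`. It follows from an exact bracket identity in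
which `h π f` appears instead of `π f h`; both represent `fh`. -/
theorem residueSymbol_mul_right {f g h : Module.End k V} (hfg : Commute f g) (hfh : Commute f h)
    (hgh : Commute g h) (hf : f ∈ almostMaps A A) (hg : g ∈ almostMaps A A)
    (hh : h ∈ almostMaps A A) :
    residueSymbol A f (g * h) = residueSymbol A (f * g) h + residueSymbol A (f * h) g := by
  set p := chosenProjection A with hp
  have hpf : p * f ∈ almostMaps ⊤ A := chosenProjection_mul_mem f
  have hsub : f * h - h * (p * f) ∈ almostMaps A ⊥ := by
    rw [hfh.eq, ← mul_sub]
    exact mul_mem_almostMaps mem_almostMaps_from_bot (sub_chosenProjection_mul_mem hf)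
  have hhp : h * (p * f) ∈ almostMaps ⊤ A := mul_mem_almostMaps hh hpf
  have hcomm : Commute (f * h) g := hfg.mul_left hgh.symm
  have hlie : ⁅p * f, g * h⁆ = ⁅p * (f * g), h⁆ + ⁅h * (p * f), g⁆ := by
    rw [hgh.eq]
    simp only [Ring.lie_def, mul_assoc]
    rw [← mul_assoc h g, ← hgh.eq]
    simp only [mul_assoc]
    abel
  rw [← finitePotentTrace_lie_eq_residueSymbol_left hcomm (mul_mem_almostMaps hf hh) hg hhp hg hsub
    (by simp), residueSymbol, residueSymbol, ← hp, hlie]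
  exact finitePotentTrace_add_of_mem_E₀
    (lie_chosenProjection_mul_mem_E₀ (hfh.mul_left hgh) (mul_mem_almostMaps hf hg) hh)
    (lie_mem_E₀_of_congr hcomm hhp hg hg hsub (by simp))

/-- The bracket maps `V` into `A` and vanishes on `A`, so its square is zero. -/
theorem residueSymbol_eq_zero_of_mapsTo {f g : Module.End k V} (hfg : Commute f g)
    (hf : ∀ x ∈ A, f x ∈ A) (hg : ∀ x ∈ A, g x ∈ A) : residueSymbol A f g = 0 := by
  set p := chosenProjection A with hp
  have hpmem : ∀ x, p x ∈ A := chosenProjection_mem A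
  have hpid : ∀ x ∈ A, p x = x := fun x => chosenProjection_apply_of_mem
  refine finitePotentTrace_eq_zero_of_sq (LinearMap.ext fun x => ?_)
  have hker : ∀ y ∈ A, ⁅p * f, g⁆ y = 0 := by
    intro y hy
    have hfgy : f (g y) = g (f y) := LinearMap.congr_fun hfg.eq y
    simp only [Ring.lie_def, LinearMap.sub_apply, Module.End.mul_apply]
    rw [hpid _ (hf _ (hg _ hy)), hpid _ (hf _ hy), hfgy, sub_self]
  rw [pow_two, Module.End.mul_apply]
  exact hker _ (A.sub_mem (hpmem _) (hg _ (hpmem _)))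

theorem residueSymbol_eq_zero_of_almostLE {f g : Module.End k V} (hfg : Commute f g)
    (hA : AlmostLE ⊤ A) (hf : f ∈ almostMaps A A) (hg : g ∈ almostMaps A A) :
    residueSymbol A f g = 0 := by
  have hf₁ : f ∈ almostMaps ⊤ A := almostMaps_mono hA (AlmostLE.of_le le_rfl) hf
  rw [← finitePotentTrace_lie_eq_residueSymbol_left hfg hf hg hf₁ hg (by simp) (by simp),
    hfg.lie_eq]
  exact finitePotentTrace_eq_zero_of_sq (by simp)

/-- Replacing `B` by a complement `B'` of `A ∩ B` in `B` changes it only by a finite-dimensional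
space. Since `A ∩ B' = 0`, there are projections `p` onto `A` killing `B'` and `q` onto `B'` killing
`A`, and `(p + q) f` represents `f` for `A + B`. -/
theorem residueSymbol_sup {f g : Module.End k V} (hfg : Commute f g)
    (hfA : f ∈ almostMaps A A) (hfB : f ∈ almostMaps B B) (hgA : g ∈ almostMaps A A)
    (hgB : g ∈ almostMaps B B) (hAB : FiniteDimensional k ↥(A ⊓ B)) :
    residueSymbol (A ⊔ B) f g = residueSymbol A f g + residueSymbol B f g := by
  obtain ⟨B', hdisj, hsup⟩ :=
    IsModularLattice.exists_disjoint_and_sup_eq (inf_le_right : A ⊓ B ≤ B)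
  have hB'B : B' ≤ B := hsup ▸ le_sup_right
  have hAB' : Disjoint A B' := by
    rw [disjoint_iff_inf_le] at hdisj ⊢
    exact (le_inf (le_inf inf_le_left (inf_le_right.trans hB'B)) inf_le_right).trans hdisj
  have hle : AlmostLE B B' := almostLE_iff.mpr
    ⟨A ⊓ B, Module.Finite.iff_fg.mp hAB, by rw [sup_comm, hsup]⟩
  have hBto : almostMaps B B ≤ almostMaps B' B' := almostMaps_mono (AlmostLE.of_le hB'B) hle
  have hBfrom : almostMaps B' ⊥ ≤ almostMaps B ⊥ := almostMaps_mono hle (AlmostLE.of_le le_rfl)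
  obtain ⟨p, hpA, hpid, hp0⟩ := exists_projection_of_disjoint hAB'
  obtain ⟨q, hqB, hqid, hq0⟩ := exists_projection_of_disjoint hAB'.symm
  have hfS : f ∈ almostMaps (A ⊔ B) (A ⊔ B) := mem_almostMaps_sup
    (almostMaps_mono (AlmostLE.of_le le_rfl) (AlmostLE.of_le le_sup_left) hfA)
    (almostMaps_mono (AlmostLE.of_le le_rfl) (AlmostLE.of_le le_sup_right) hfB)
  have hgS : g ∈ almostMaps (A ⊔ B) (A ⊔ B) := mem_almostMaps_sup
    (almostMaps_mono (AlmostLE.of_le le_rfl) (AlmostLE.of_le le_sup_left) hgA)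
    (almostMaps_mono (AlmostLE.of_le le_rfl) (AlmostLE.of_le le_sup_right) hgB)
  have hpf₁ : p * f ∈ almostMaps ⊤ A := mul_mem_almostMaps_of_projection hpA f
  have hqf₁ : q * f ∈ almostMaps ⊤ B' := mul_mem_almostMaps_of_projection hqB f
  have hqf₁' : q * f ∈ almostMaps ⊤ B :=
    almostMaps_mono (AlmostLE.of_le le_rfl) (AlmostLE.of_le hB'B) hqf₁
  have hpf₂ : f - p * f ∈ almostMaps A ⊥ := sub_mul_mem_almostMaps_of_projection hpid hfA
  have hqf₂ : f - q * f ∈ almostMaps B ⊥ :=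
    hBfrom (sub_mul_mem_almostMaps_of_projection hqid (hBto hfB))
  have hpB : p * f ∈ almostMaps B' ⊥ := mul_mem_almostMaps
    (mem_almostMaps_of_mapsTo fun x hx => by simp [hp0 x hx]) (hBto hfB)
  have hqA : q * f ∈ almostMaps A ⊥ := mul_mem_almostMaps
    (mem_almostMaps_of_mapsTo fun x hx => by simp [hq0 x hx]) hfA
  have hsum : f - (p + q) * f ∈ almostMaps (A ⊔ B) ⊥ := by
    refine mem_almostMaps_sup ?_ ?_
    · rw [add_mul, ← sub_sub]
      exact sub_mem hpf₂ hqA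
    · rw [add_mul, add_comm, ← sub_sub]
      exact sub_mem hqf₂ (hBfrom hpB)
  have hsum₁ : (p + q) * f ∈ almostMaps ⊤ (A ⊔ B) := by
    rw [add_mul]
    exact add_mem
      (almostMaps_mono (AlmostLE.of_le le_rfl) (AlmostLE.of_le le_sup_left) hpf₁)
      (almostMaps_mono (AlmostLE.of_le le_rfl) (AlmostLE.of_le le_sup_right) hqf₁')
  have hφ₁ : ⁅p * f, g⁆ ∈ E₀ A := lie_mem_E₀_of_congr hfg hpf₁ hgA hgA hpf₂ (by simp)
  have hψ₁ : ⁅q * f, g⁆ ∈ E₀ B := lie_mem_E₀_of_congr hfg hqf₁' hgB hgB hqf₂ (by simp)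
  have hφ₂ : ⁅p * f, g⁆ ∈ almostMaps B ⊥ := hBfrom (lie_mem_almostMaps_bot hpB (hBto hgB))
  have hψ₂ : ⁅q * f, g⁆ ∈ almostMaps A ⊥ := lie_mem_almostMaps_bot hqA hgA
  rw [← finitePotentTrace_lie_eq_residueSymbol_left hfg hfS hgS hsum₁ hgS hsum (by simp),
    ← finitePotentTrace_lie_eq_residueSymbol_left hfg hfA hgA hpf₁ hgA hpf₂ (by simp),
    ← finitePotentTrace_lie_eq_residueSymbol_left hfg hfB hgB hqf₁' hgB hqf₂ (by simp),
    add_mul, ring_add_lie]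
  -- The brackets lie in `E₀ A` and `E₀ B` respectively; the mixed products have finite rank because
  -- each bracket also has finite rank on the other subspace.
  exact finitePotentTrace_add (mul_mem_almostMaps hφ₁.2 hφ₁.1) (mul_mem_almostMaps hφ₂ hψ₁.1)
    (mul_mem_almostMaps hψ₂ hφ₁.1) (mul_mem_almostMaps hψ₁.2 hψ₁.1)

end ResidueSymbol

/-! ### Existence and uniqueness of the abstract residue -/

section Existence

variable {k K : Type*} [Field k] [CommRing K] [Algebra k K]

/-- The `K`-module structure on the `k`-dual of a commutative `k`-algebra `K`, acting on the
argument. -/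
abbrev dualModule (k K : Type*) [Field k] [CommRing K] [Algebra k K] :
    Module K (K →ₗ[k] k) where
  smul a ℓ := ℓ ∘ₗ LinearMap.mulLeft k a
  one_smul ℓ := LinearMap.ext fun x => congrArg ℓ (one_mul x)
  mul_smul a b ℓ := LinearMap.ext fun x => congrArg ℓ (by simp [mul_left_comm])
  smul_zero _ := rfl
  smul_add _ _ _ := rfl
  add_smul a b ℓ := LinearMap.ext fun x => by
    change ℓ ((a + b) * x) = ℓ (a * x) + ℓ (b * x)
    rw [add_mul, map_add]
  zero_smul ℓ := LinearMap.ext fun x => by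
    change ℓ (0 * x) = 0
    rw [zero_mul, map_zero]

/-- The hypothesis says that `B` is a derivation from `K` into its `k`-dual. The universal property
lifts it to the differentials, and evaluation at `1` gives the functional. -/
theorem exists_linearMap_kaehlerDifferential (B : K →ₗ[k] K →ₗ[k] k)
    (hB : ∀ f g h, B (g * h) f = B h (f * g) + B g (f * h)) :
    ∃ r : Ω[K⁄k] →ₗ[k] k, ∀ f g, r (f • KaehlerDifferential.D k K g) = B g f := by
  let _ := dualModule k K
  have hsmul : ∀ (a : K) (ℓ : K →ₗ[k] k) (x : K), (a • ℓ) x = ℓ (a * x) := fun _ _ _ => rfl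
  have : IsScalarTower k K (K →ₗ[k] k) := ⟨fun c a ℓ => LinearMap.ext fun x => by
    rw [hsmul, LinearMap.smul_apply, hsmul, smul_mul_assoc, map_smul]⟩
  let d : Derivation k K (K →ₗ[k] k) := Derivation.mk' B fun a b => LinearMap.ext fun x => by
    rw [LinearMap.add_apply, hsmul, hsmul, hB, mul_comm a x, mul_comm b x]
  refine ⟨LinearMap.applyₗ (1 : K) ∘ₗ d.liftKaehlerDifferential.restrictScalars k, fun f g => ?_⟩
  simp only [LinearMap.comp_apply, LinearMap.restrictScalars_apply, map_smul,
    Derivation.liftKaehlerDifferential_comp_D]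
  change (f • B g) 1 = _
  rw [hsmul, mul_one]

variable {V : Type*} [AddCommGroup V] [Module k V] [Module K V] [IsScalarTower k K V]

theorem commute_lsmul (f g : K) :
    Commute (Algebra.lsmul k k V f) (Algebra.lsmul k k V g) :=
  (Commute.all f g).map (Algebra.lsmul k k V)

/-- The residue symbol as a bilinear form on `K`, in the order `(g, f)`. -/
def residueForm (A : Submodule k V) (hA : ∀ f : K, Algebra.lsmul k k V f ∈ E A) :
    K →ₗ[k] K →ₗ[k] k :=
  have hmem (f g : K) :=
    lie_chosenProjection_mul_mem_E₀ (commute_lsmul (V := V) f g) (hA f) (hA g)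
  LinearMap.mk₂ k
    (fun g f => residueSymbol A (Algebra.lsmul k k V f) (Algebra.lsmul k k V g))
    (fun g₁ g₂ f => by
      rw [residueSymbol, map_add, ring_lie_add]
      exact finitePotentTrace_add_of_mem_E₀ (hmem f g₁) (hmem f g₂))
    (fun c g f => by
      rw [residueSymbol, map_smul, Ring.lie_def, mul_smul_comm, smul_mul_assoc, ← smul_sub, ← Ring.lie_def]
      exact finitePotentTrace_smul (finitePotent_of_mem_E₀ (hmem f g)) c)
    (fun g f₁ f₂ => by
      rw [residueSymbol, map_add, mul_add, ring_add_lie]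
      exact finitePotentTrace_add_of_mem_E₀ (hmem f₁ g) (hmem f₂ g))
    (fun c g f => by
      rw [residueSymbol, map_smul, mul_smul_comm, Ring.lie_def, mul_smul_comm, smul_mul_assoc, ← smul_sub,
        ← Ring.lie_def]
      exact finitePotentTrace_smul (finitePotent_of_mem_E₀ (hmem f g)) c)

theorem IsAbstractResidue.apply_smul_D {A : Submodule k V} {r : Ω[K⁄k] →ₗ[k] k}
    (hr : IsAbstractResidue K A r) (hA : ∀ f : K, Algebra.lsmul k k V f ∈ E A) (f g : K) :
    r (f • KaehlerDifferential.D k K g) =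
      residueSymbol A (Algebra.lsmul k k V f) (Algebra.lsmul k k V g) :=
  (hr f g _ _ (almostMaps_top_le (chosenProjection_mul_mem _)) (hA g)
    (sub_chosenProjection_mul_mem (hA f))
    (mem_E₂_iff.mpr (by simp)) (Or.inl (chosenProjection_mul_mem _))).2

theorem existsUnique_isAbstractResidue {A : Submodule k V}
    (hA : ∀ f : K, Algebra.lsmul k k V f ∈ E A) :
    ∃! r : Ω[K⁄k] →ₗ[k] k, IsAbstractResidue K A r := by
  obtain ⟨r, hr⟩ := exists_linearMap_kaehlerDifferential (residueForm A hA) fun f g h => by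
    simp only [residueForm, LinearMap.mk₂_apply, map_mul]
    exact residueSymbol_mul_right (commute_lsmul f g) (commute_lsmul f h) (commute_lsmul g h)
      (hA f) (hA g) (hA h)
  refine ⟨r, fun f g f₁ g₁ hf₁ hg₁ hff₁ hgg₁ h => ?_, fun s hs => ?_⟩
  · obtain ⟨h₀, htr⟩ := lie_mem_E₀_and_trace_eq_residueSymbol (commute_lsmul f g) (hA f) (hA g)
      hf₁ hg₁ hff₁ hgg₁ h
    exact ⟨finitePotent_of_mem_E₀ h₀, (hr f g).trans htr.symm⟩
  · refine LinearMap.ext fun ω => ?_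
    have hω : ω ∈ Submodule.span K (Set.range (KaehlerDifferential.D k K)) := by
      rw [KaehlerDifferential.span_range_derivation]
      trivial
    -- The maps are only `k`-linear, so the `K`-span is treated as the additive span of the elements
    -- `a dg`.
    induction hω using Submodule.closure_induction with
    | zero => simp
    | add x y _ _ hx hy => rw [map_add, map_add, hx, hy]
    | smul_mem a x hx =>
      obtain ⟨g, rfl⟩ := hx
      rw [hs.apply_smul_D hA, hr]
      rfl

theorem abstractResidue_smul_D {A : Submodule k V}
    (hA : ∀ f : K, Algebra.lsmul k k V f ∈ E A) (f g : K) :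
    abstractResidue K A (f • KaehlerDifferential.D k K g) =
      residueSymbol A (Algebra.lsmul k k V f) (Algebra.lsmul k k V g) := by
  have h := existsUnique_isAbstractResidue hA
  rw [abstractResidue, dif_pos h]
  exact h.choose_spec.1.apply_smul_D hA f g

end Existence

/-! ### Reciprocity for admissible families -/

section Reciprocity

variable {k V I : Type*} [Field k] [AddCommGroup V] [Module k V] {W : I → Submodule k V}

theorem ReciprocityAdmissible.finiteDimensional_inf (hW : ReciprocityAdmissible W) (i : I) :
    FiniteDimensional k ↥(W i ⊓ ⨆ j, ⨆ _ : j ≠ i, W j) :=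
  almostLE_bot_iff.mp (hW.inf_commensurable i).almostLE_left

/-- If `x = ∑ μ j` over `J` also lies in the sum outside `J`, then each `μ i = x - ∑_{j ≠ i} μ j`
lies in `W i ∩ ∑_{j ≠ i} W j`, which is finite dimensional. -/
theorem ReciprocityAdmissible.finiteDimensional_finset_inf (hW : ReciprocityAdmissible W)
    (J : Finset I) :
    FiniteDimensional k ↥((⨆ i ∈ J, W i) ⊓ ⨆ i, ⨆ _ : i ∉ J, W i) := by
  classical
  have hfin := hW.finiteDimensional_inf
  have hle : (⨆ i ∈ J, W i) ⊓ (⨆ i, ⨆ _ : i ∉ J, W i) ≤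
      ⨆ i ∈ J, W i ⊓ ⨆ j, ⨆ _ : j ≠ i, W j := by
    rintro x ⟨hxJ, hx⟩
    obtain ⟨μ, rfl⟩ := (Submodule.mem_iSup_finset_iff_exists_sum _ _).mp hxJ
    refine Submodule.sum_mem _ fun i hi => Submodule.mem_iSup_of_mem i
      (Submodule.mem_iSup_of_mem hi ⟨(μ i).2, ?_⟩)
    have hμ : (μ i : V) = (∑ j ∈ J, (μ j : V)) - ∑ j ∈ J.erase i, (μ j : V) := by
      rw [← Finset.add_sum_erase J _ hi, add_sub_cancel_right]
    rw [hμ]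
    refine Submodule.sub_mem _ ?_ (Submodule.sum_mem _ fun j hj =>
      Submodule.mem_iSup_of_mem j (Submodule.mem_iSup_of_mem (Finset.ne_of_mem_erase hj) (μ j).2))
    have hmono : (⨆ j, ⨆ _ : j ∉ J, W j) ≤ ⨆ j, ⨆ _ : j ≠ i, W j :=
      iSup_mono fun j => iSup_mono' fun hj => ⟨fun h => hj (h ▸ hi), le_rfl⟩
    exact hmono hx
  have : FiniteDimensional k ↥(⨆ i ∈ J, W i ⊓ ⨆ j, ⨆ _ : j ≠ i, W j) :=
    Module.Finite.iff_fg.mpr (Submodule.fg_biSup J _ fun i _ => Module.Finite.iff_fg.mp (hfin i))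
  exact Submodule.finiteDimensional_of_le hle

theorem mem_almostMaps_finset_iSup {f : Module.End k V} (hf : ∀ i, f ∈ almostMaps (W i) (W i))
    (J : Finset I) : f ∈ almostMaps (⨆ i ∈ J, W i) (⨆ i ∈ J, W i) := by
  classical
  induction J using Finset.induction_on with
  | empty => simpa using mem_almostMaps_from_bot
  | insert i J _ ih =>
    rw [Finset.iSup_insert]
    exact mem_almostMaps_sup
      (almostMaps_mono (AlmostLE.of_le le_rfl) (AlmostLE.of_le le_sup_left) (hf i))
      (almostMaps_mono (AlmostLE.of_le le_rfl) (AlmostLE.of_le le_sup_right) ih)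

/-- By induction on `J`: the new `W i` meets the previous sum in a finite-dimensional space, so
`residueSymbol_sup` applies. -/
theorem ReciprocityAdmissible.residueSymbol_finset_iSup (hW : ReciprocityAdmissible W)
    {f g : Module.End k V} (hfg : Commute f g) (hf : ∀ i, f ∈ almostMaps (W i) (W i))
    (hg : ∀ i, g ∈ almostMaps (W i) (W i)) (J : Finset I) :
    residueSymbol (⨆ i ∈ J, W i) f g = ∑ i ∈ J, residueSymbol (W i) f g := by
  classical
  induction J using Finset.induction_on with
  | empty =>
    simpa using residueSymbol_eq_zero_of_mapsTo (A := ⊥) hfg (by simp) (by simp)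
  | insert i J hi ih =>
    have hfin := hW.finiteDimensional_inf i
    have hle : (⨆ j ∈ J, W j) ≤ ⨆ j, ⨆ _ : j ≠ i, W j :=
      iSup_mono fun j => iSup_mono' fun hj => ⟨fun h => hi (h ▸ hj), le_rfl⟩
    rw [Finset.iSup_insert, Finset.sum_insert hi, ← ih]
    exact residueSymbol_sup hfg (hf i) (mem_almostMaps_finset_iSup hf J) (hg i)
      (mem_almostMaps_finset_iSup hg J)
      (Submodule.finiteDimensional_of_le (inf_le_inf_left (W i) hle))

theorem mapsTo_iSup_compl {f : Module.End k V} {J : Finset I}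
    (hf : ∀ i ∉ J, ∀ x ∈ W i, f x ∈ W i) :
    ∀ x ∈ ⨆ i, ⨆ _ : i ∉ J, W i, f x ∈ ⨆ i, ⨆ _ : i ∉ J, W i := by
  change (⨆ i, ⨆ _ : i ∉ J, W i) ≤ (⨆ i, ⨆ _ : i ∉ J, W i).comap f
  exact iSup₂_le fun i hi x hx =>
    Submodule.mem_iSup_of_mem i (Submodule.mem_iSup_of_mem hi (hf i hi x hx))

theorem ReciprocityAdmissible.sum_residueSymbol_eq_zero (hW : ReciprocityAdmissible W)
    {f g : Module.End k V} (hfg : Commute f g) (hf : ∀ i, f ∈ almostMaps (W i) (W i))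
    (hg : ∀ i, g ∈ almostMaps (W i) (W i)) {J : Finset I}
    (hfJ : ∀ i ∉ J, ∀ x ∈ W i, f x ∈ W i) (hgJ : ∀ i ∉ J, ∀ x ∈ W i, g x ∈ W i) :
    ∑ i ∈ J, residueSymbol (W i) f g = 0 := by
  have hf' := mapsTo_iSup_compl hfJ
  have hg' := mapsTo_iSup_compl hgJ
  have hfJ' := mem_almostMaps_finset_iSup hf J
  have hgJ' := mem_almostMaps_finset_iSup hg J
  have hfC := mem_almostMaps_of_mapsTo hf'
  have hgC := mem_almostMaps_of_mapsTo hg'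
  have hsup := residueSymbol_sup hfg hfJ' hfC hgJ' hgC (hW.finiteDimensional_finset_inf J)
  have htop : AlmostLE ⊤ ((⨆ i ∈ J, W i) ⊔ ⨆ i, ⨆ _ : i ∉ J, W i) := by
    rw [← iSup_split W (· ∈ J)]
    exact hW.iSup_commensurable.almostLE_right
  rw [residueSymbol_eq_zero_of_mapsTo hfg hf' hg', add_zero,
    hW.residueSymbol_finset_iSup hfg hf hg J] at hsup
  rw [← hsup]
  -- A subspace commensurable with `V` is almost preserved by every endomorphism.
  have hmem : ∀ φ : Module.End k V, φ ∈ almostMaps ((⨆ i ∈ J, W i) ⊔ ⨆ i, ⨆ _ : i ∉ J, W i)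
      ((⨆ i ∈ J, W i) ⊔ ⨆ i, ⨆ _ : i ∉ J, W i) := fun φ =>
    almostMaps_mono (AlmostLE.of_le le_top) htop (mem_almostMaps_top_top (φ := φ))
  exact residueSymbol_eq_zero_of_almostLE hfg htop (hmem f) (hmem g)

theorem mapsTo_of_map_eq_or {f : Module.End k V} {A : Submodule k V}
    (h : A.map f = A ∨ A.map f = ⊥) : ∀ x ∈ A, f x ∈ A :=
  Submodule.map_le_iff_le_comap.mp (h.elim (fun h => h.le) fun h => h.le.trans bot_le)

end Reciprocity

end TateResidue

end

/-! ### The reciprocity law -/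

theorem mainTheorem7 {k K V I : Type*} [Field k] [CommRing K] [Algebra k K]
    [AddCommGroup V] [Module k V] [Module K V] [IsScalarTower k K V]
    (W : I → Submodule k V) (hW : TateResidue.ReciprocityAdmissible W)
    (hK : ∀ f : K, Algebra.lsmul k k V f ∈ TateResidue.restrictedEnd W) :
    (∀ i, ∃! r : Ω[K⁄k] →ₗ[k] k, TateResidue.IsAbstractResidue K (W i) r) ∧
    ∀ g h : K,
      {i | TateResidue.abstractResidue K (W i) (g • KaehlerDifferential.D k K h) ≠ 0}.Finite ∧
      ∑ᶠ i, TateResidue.abstractResidue K (W i) (g • KaehlerDifferential.D k K h) = 0 := by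
  classical
  have hE : ∀ i, ∀ f : K, Algebra.lsmul k k V f ∈ TateResidue.E (W i) := fun i f => (hK f).1 i
  refine ⟨fun i => TateResidue.existsUnique_isAbstractResidue (hE i), fun g h => ?_⟩
  simp only [fun i => TateResidue.abstractResidue_smul_D (hE i) g h]
  have hcomm := TateResidue.commute_lsmul (k := k) (V := V) g h
  -- Outside these exceptional indices, both `g` and `h` send `W i` onto itself or to zero, hence
  -- into itself.
  let J : Finset I := (hK g).2.toFinset ∪ (hK h).2.toFinset
  have hgJ : ∀ i ∉ J, ∀ x ∈ W i, Algebra.lsmul k k V g x ∈ W i := fun i hi =>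
    TateResidue.mapsTo_of_map_eq_or (by
      by_contra hcon
      exact hi (Finset.mem_union_left _ ((hK g).2.mem_toFinset.mpr hcon)))
  have hhJ : ∀ i ∉ J, ∀ x ∈ W i, Algebra.lsmul k k V h x ∈ W i := fun i hi =>
    TateResidue.mapsTo_of_map_eq_or (by
      by_contra hcon
      exact hi (Finset.mem_union_right _ ((hK h).2.mem_toFinset.mpr hcon)))
  have hsupp : ∀ i, TateResidue.residueSymbol (W i) (Algebra.lsmul k k V g)
      (Algebra.lsmul k k V h) ≠ 0 → i ∈ J := by
    intro i hi
    by_contra hiJ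
    exact hi (TateResidue.residueSymbol_eq_zero_of_mapsTo hcomm (hgJ i hiJ) (hhJ i hiJ))
  refine ⟨J.finite_toSet.subset hsupp, ?_⟩
  rw [finsum_eq_sum_of_support_subset _ (s := J) hsupp]
  exact hW.sum_residueSymbol_eq_zero hcomm (fun i => hE i g) (fun i => hE i h) hgJ hhJ
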